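/- All digraphs are labelled, finite, without loops or multiple edges (both $x\to y$ and $y\to x$ may be present); a digraph with $n$ vertices has vertex set $\{0,\dots,n-1\}$. A *family* $\mathcal F$ is a set of such digraphs, and $e(G)$ denotes the number of directed edges of $G$. Let $w,u$ be formal variables; all series below are formal power series in $z$ over the field $\mathbb Q(w,u)$. With $f_n(w)=\sum_{G\in\mathcal F,\ |V(G)|=n}w^{e(G)}$, the exponential generating function (EGF) and the graphic generating function (GGF) of $\mathcal F$ are $$F(z,w)=\sum_{n\ge0}f_n(w)\frac{z^n}{n!},\qquad \mathbf F(z,w)=\sum_{n\ge0}\frac{f_n(w)}{(1+w)^{\binom n2}}\frac{z^n}{n!}.$$ The exponential Hadamard product is $\bigl(\sum_n a_n\frac{z^n}{n!}\bigr)\odot\bigl(\sum_n b_n\frac{z^n}{n!}\bigr)=\sum_n a_nb_n\frac{z^n}{n!}$, and $\mathbf{Set}(z,w)=\sum_{n\ge0}(1+w)^{-\binom n2}\frac{z^n}{n!}$ is the GGF of the labelled graphs without edges. The *condensation* of a digraph is the digraph whose vertices are its strongly connected components, with an edge from $C$ to $C'\ne C$ when some edge goes from a vertex of $C$ to a vertex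 of $C'$; a component is *source-like* if no edge of the condensation points to it. The empty digraph is not strongly connected. **Theorem.** Let $\mathcal A$ be a nonempty family of strongly connected digraphs, with EGF $A(z,w)$. Let $\mathcal D_{\mathcal A}$ be the family of all digraphs (including the empty one) each of whose strongly connected components, relabelled by $0,1,\dots$ in increasing order of its labels, belongs to $\mathcal A$. (If $\mathcal A$ is closed under relabelling, this just says that each component is isomorphic to a member of $\mathcal A$.) Then $\mathbf{Set}(z,w)\odot e^{-A(z,w)}$ is an invertible power series, and the GGF of $\mathcal D_{\mathcal A}$ is $$\mathbf D_{\mathcal A}(z,w)=\frac{1}{\mathbf{Set}(z,w)\odot e^{-A(z,w)}}.$$ Moreover, the GGF of the same family in which $u$ marks the source-like components, that is $$\mathbf D_{\mathcal A}(z,w,u)=\sum_{n\ge0}\ \Bigl(\sum_{G\in\mathcal D_{\mathcal A},\ |V(G)|=n}w^{e(G)}u^{s(G)}\Bigr)(1+w)^{-\binom n2}\frac{z^n}{n!},$$ where $s(G)$ is the number of source-like components of $G$, is $$\mathbf D_{\mathcal A}(z,w,u)=\frac{\mathbf{Set}(z,w)\odot e^{(u-1)A(z,w)}}{\mathbf{Set}(z,w)\odot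 e^{-A(z,w)}}.$$ -/

import Mathlib

open scoped Nat

noncomputable section

namespace LabelledDigraph

/-! ### Digraphs, strong connectivity and condensations -/

section Graphs

variable {V : Type*}

/-- No loops. (Multiple edges are excluded by the type `Digraph`.) -/
def Loopless (G : Digraph V) : Prop := ∀ v, ¬ G.Adj v v

/-- There is a directed path, possibly of length zero, from `x` to `y`. -/
def Reaches (G : Digraph V) (x y : V) : Prop := Relation.ReflTransGen G.Adj x y

/-- A digraph is strongly connected if it is nonempty and every vertex reaches every vertex. -/
def StronglyConnected (G : Digraph V) : Prop := Nonempty V ∧ ∀ x y, Reaches G x y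

/-- A source of a digraph: no edge points to it. -/
def IsSource (G : Digraph V) (v : V) : Prop := ∀ x, ¬ G.Adj x v

variable [Fintype V]

open Classical in
/-- The number of directed edges. -/
def edgeCount (G : Digraph V) : ℕ :=
  (Finset.univ.filter fun p : V × V => G.Adj p.1 p.2).card

open Classical in
/-- The vertex set of the strongly connected component of `v`. -/
def component (G : Digraph V) (v : V) : Finset V :=
  Finset.univ.filter fun x => Reaches G v x ∧ Reaches G x v

open Classical in
/-- The vertex sets of the strongly connected components of `G`. -/
def components (G : Digraph V) : Finset (Finset V) :=
  Finset.univ.image (component G)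

/-- The condensation of `G`: its vertices are the strongly connected components of `G`, with an
edge from `C` to `C'` when these are distinct and some edge of `G` goes from `C` to `C'`. -/
def condensation (G : Digraph V) : Digraph {C : Finset V // C ∈ components G} where
  Adj C C' := C ≠ C' ∧ ∃ x ∈ C.1, ∃ y ∈ C'.1, G.Adj x y

/-- The number of source-like components, that is, of sources of the condensation. -/
def sourceLikeCount (G : Digraph V) : ℕ :=
  Nat.card {C : {C : Finset V // C ∈ components G} // IsSource (condensation G) C}

end Graphs

/-- The subdigraph of `G` induced on `C`, its vertices relabelled by `0, …, |C| - 1` in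
increasing order. -/
def inducedOn {n : ℕ} (G : Digraph (Fin n)) (C : Finset (Fin n)) : Digraph (Fin C.card) where
  Adj i j := G.Adj (C.orderEmbOfFin rfl i) (C.orderEmbOfFin rfl j)

/-! ### Families of labelled digraphs -/

/-- A family of labelled digraphs: for each `n`, a set of digraphs with vertex set
`{0, …, n - 1}`. No closure under relabelling is required. -/
abbrev Family := ∀ n : ℕ, Set (Digraph (Fin n))

/-- Labelled graphs without edges, one of each size. -/
def edgeless : Family := fun _ => {⊥}

/-- The loopless digraphs all of whose strongly connected components belong to `A`. -/
def withComponentsIn (A : Family) : Family := fun _ =>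
  {G | Loopless G ∧ ∀ C ∈ components G, inducedOn G C ∈ A C.card}

/-! ### Generating functions

Power series in `z` over a field `K` that contains the values of the variables `w`, `u`. -/

section Series

variable {K : Type*} [Field K]

/-- The exponential generating function `∑ aₙ zⁿ / n!`. -/
def egf (a : ℕ → K) : PowerSeries K := PowerSeries.mk fun n => a n / (n ! : K)

/-- The graphic generating function `∑ aₙ / (1 + w) ^ (n choose 2) zⁿ / n!`. -/
def ggf (w : K) (a : ℕ → K) : PowerSeries K :=
  PowerSeries.mk fun n => a n / (1 + w) ^ n.choose 2 / (n ! : K)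

/-- The exponential Hadamard product: if `A = ∑ aₙ zⁿ / n!` and `B = ∑ bₙ zⁿ / n!`, it is
`∑ aₙ bₙ zⁿ / n!`. -/
def expHadamard (A B : PowerSeries K) : PowerSeries K :=
  egf fun n => ((n ! : K) * PowerSeries.coeff n A) * ((n ! : K) * PowerSeries.coeff n B)

/-- `e ^ F`, for a power series `F` without constant term. -/
def expSeries [Algebra ℚ K] (F : PowerSeries K) : PowerSeries K := (PowerSeries.exp K).subst F

open Classical in
/-- The sequence `aₙ(w)` of a family: the sum of `w ^ (number of edges)` over its members with
`n` vertices. -/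
def weightSeq (w : K) (A : Family) (n : ℕ) : K :=
  ∑ G ∈ Finset.univ.filter fun G : Digraph (Fin n) => G ∈ A n, w ^ edgeCount G

open Classical in
/-- The same sequence with the source-like components marked by `u`. -/
def weightSeqMarked (w u : K) (A : Family) (n : ℕ) : K :=
  ∑ G ∈ Finset.univ.filter fun G : Digraph (Fin n) => G ∈ A n,
    w ^ edgeCount G * u ^ sourceLikeCount G

end Series

/-! ### The formal variables -/

/-- The field `ℚ(w, u)`. -/
abbrev Coefficients := FractionRing (MvPolynomial (Fin 2) ℚ)

/-- The formal variable that marks edges. -/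
def w : Coefficients := algebraMap (MvPolynomial (Fin 2) ℚ) Coefficients (MvPolynomial.X 0)

/-- The formal variable that marks source-like components. -/
def u : Coefficients := algebraMap (MvPolynomial (Fin 2) ℚ) Coefficients (MvPolynomial.X 1)

/-- The exponential generating function `A(z, w)` of a family. -/
def familyEGF (A : Family) : PowerSeries Coefficients := egf (weightSeq w A)

/-- The graphic generating function of a family. -/
def familyGGF (A : Family) : PowerSeries Coefficients := ggf w (weightSeq w A)

/-- The graphic generating function of a family, with `u` marking source-like components. -/
def familyGGFMarked (A : Family) : PowerSeries Coefficients := ggf w (weightSeqMarked w u A)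

end LabelledDigraph

end

/-! Put `u = 1 + t`. Then `(1 + t) ^ s(G)` is the sum of `t ^ |T|` over the sets `T` of source-like
components of `G`, and `T` is determined by its union `S` (`sum_sourceUnion`). No edge enters `S`
from outside, so a pair `(G, S)` amounts to three independent choices: a disjoint union of digraphs
from `A` on `S`, a digraph with components in `A` on the complement, and any set of edges from `S`
to the complement. The last choice contributes `(1 + w) ^ (|S| |Sᶜ|)` (`sum_marked_eq`).

By `add_choose_two` this is exactly the factor that the graphic normalisation absorbs, and the
disjoint unions have EGF `e ^ (t A)` (`expSeries_eq_egf_isolatedWeight`). Hence `D(1 + t) = (Set ⊙ e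
^ (t A)) * D`, which is `ggf_weightSeqMarked`.

At `t = -1` only digraphs without source-like components survive. Every nonempty digraph has one
(`sourceLikeCount_ne_zero`), so the left side is `1`; this gives both the invertibility and the
formula for `D`. The marked formula is the case `t = u - 1`.

Since `A` need not be closed under relabelling, vertex sets are linearly ordered throughout, and
membership in `A` is transported only along order embeddings. -/

noncomputable section

namespace LabelledDigraph

open Classical

/-! ### Pulling digraphs back along maps -/

section Pullback

variable {V W : Type*}

/-- The digraph on `W` obtained from a digraph on `V` along a map `W → V`. -/
def pullback (f : W → V) (G : Digraph V) : Digraph W where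
  Adj a b := G.Adj (f a) (f b)

lemma Reaches.of_pullback {f : W → V} {G : Digraph V} {a b : W}
    (h : Reaches (pullback f G) a b) : Reaches G (f a) (f b) := by
  induction h with
  | refl => exact .refl
  | tail _ h ih => exact ih.tail h

/-- No edge enters `S` from outside. -/
def PredClosed (G : Digraph V) (S : Set V) : Prop := ∀ x y, G.Adj x y → y ∈ S → x ∈ S

/-- No edge leaves `S`. -/
def SuccClosed (G : Digraph V) (S : Set V) : Prop := ∀ x y, G.Adj x y → x ∈ S → y ∈ S

/-- The strongly connected components of the pullback of `G` along `f` are exactly the strongly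
connected components of `G` that meet the range of `f`. -/
structure ReflectsComponents (f : W → V) (G : Digraph V) : Prop where
  reaches : ∀ a b, Reaches G (f a) (f b) → Reaches (pullback f G) a b
  mem_range : ∀ a y, Reaches G (f a) y → Reaches G y (f a) → y ∈ Set.range f

/-- A path followed backwards from the range never leaves it, so the whole path lifts. -/
lemma PredClosed.exists_reaches {f : W → V} {G : Digraph V} (h : PredClosed G (Set.range f))
    {x : V} {b : W} (hx : Reaches G x (f b)) : ∃ a, f a = x ∧ Reaches (pullback f G) a b := by
  induction hx using Relation.ReflTransGen.head_induction_on with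
  | refl => exact ⟨b, rfl, .refl⟩
  | head hxy _ ih =>
    obtain ⟨a, rfl, ha⟩ := ih
    obtain ⟨c, rfl⟩ := h _ _ hxy ⟨a, rfl⟩
    exact ⟨c, rfl, .head hxy ha⟩

lemma SuccClosed.exists_reaches {f : W → V} {G : Digraph V} (h : SuccClosed G (Set.range f))
    {a : W} {y : V} (hy : Reaches G (f a) y) : ∃ b, f b = y ∧ Reaches (pullback f G) a b := by
  induction hy with
  | refl => exact ⟨a, rfl, .refl⟩
  | tail _ hxy ih =>
    obtain ⟨b, rfl, hb⟩ := ih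
    obtain ⟨c, rfl⟩ := h _ _ hxy ⟨b, rfl⟩
    exact ⟨c, rfl, .tail hb hxy⟩

lemma PredClosed.reflectsComponents {f : W → V} (hf : Function.Injective f) {G : Digraph V}
    (h : PredClosed G (Set.range f)) : ReflectsComponents f G where
  reaches a b hab := by
    obtain ⟨c, hc, h⟩ := h.exists_reaches hab
    rwa [hf hc] at h
  mem_range a y _ hy := by
    obtain ⟨c, hc, -⟩ := h.exists_reaches hy
    exact ⟨c, hc⟩

lemma SuccClosed.reflectsComponents {f : W → V} (hf : Function.Injective f) {G : Digraph V}
    (h : SuccClosed G (Set.range f)) : ReflectsComponents f G where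
  reaches a b hab := by
    obtain ⟨c, hc, h⟩ := h.exists_reaches hab
    rwa [hf hc] at h
  mem_range a y hy _ := by
    obtain ⟨c, hc, -⟩ := h.exists_reaches hy
    exact ⟨c, hc⟩

lemma ReflectsComponents.reaches_iff {f : W → V} {G : Digraph V} (h : ReflectsComponents f G)
    {a b : W} : Reaches (pullback f G) a b ↔ Reaches G (f a) (f b) :=
  ⟨Reaches.of_pullback, h.reaches a b⟩

/-- No edge joins two different strongly connected components. -/
def ComponentsIsolated (G : Digraph V) : Prop := ∀ x y, G.Adj x y → Reaches G y x

lemma ReflectsComponents.componentsIsolated_pullback {f : W → V} {G : Digraph V}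
    (h : ReflectsComponents f G) :
    ComponentsIsolated (pullback f G) ↔
      ∀ a b, G.Adj (f a) (f b) → Reaches G (f b) (f a) := by
  simp only [ComponentsIsolated, h.reaches_iff]
  rfl

end Pullback

/-! ### Strongly connected components as a partition of the vertices -/

section Components

variable {V W : Type*} [Fintype V] [Fintype W]

lemma mem_component {G : Digraph V} {v x : V} :
    x ∈ component G v ↔ Reaches G v x ∧ Reaches G x v := by
  simp [component]

lemma self_mem_component (G : Digraph V) (v : V) : v ∈ component G v :=
  mem_component.2 ⟨.refl, .refl⟩

lemma component_eq_of_mem {G : Digraph V} {v x : V} (h : x ∈ component G v) :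
    component G x = component G v := by
  rw [mem_component] at h
  ext y
  simp only [mem_component]
  exact ⟨fun hy => ⟨h.1.trans hy.1, hy.2.trans h.2⟩, fun hy => ⟨h.2.trans hy.1, hy.2.trans h.1⟩⟩

lemma component_mem_components (G : Digraph V) (v : V) : component G v ∈ components G :=
  Finset.mem_image_of_mem _ (Finset.mem_univ v)

lemma exists_component_eq {G : Digraph V} {C : Finset V} (hC : C ∈ components G) :
    ∃ v, component G v = C := by
  simpa [components] using hC

lemma eq_component_of_mem {G : Digraph V} {C : Finset V} (hC : C ∈ components G) {v : V}
    (hv : v ∈ C) : C = component G v := by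
  obtain ⟨x, rfl⟩ := exists_component_eq hC
  exact (component_eq_of_mem hv).symm

lemma nonempty_of_mem_components {G : Digraph V} {C : Finset V} (hC : C ∈ components G) :
    C.Nonempty := by
  obtain ⟨x, rfl⟩ := exists_component_eq hC
  exact ⟨x, self_mem_component G x⟩

/-- The number of strongly connected components. -/
def numComponents (G : Digraph V) : ℕ := (components G).card

lemma ReflectsComponents.coe_component {f : W → V} {G : Digraph V} (h : ReflectsComponents f G)
    (a : W) : (component G (f a) : Set V) = f '' (component (pullback f G) a) := by
  ext y
  simp only [Finset.mem_coe, mem_component, Set.mem_image, h.reaches_iff]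
  constructor
  · rintro ⟨h₁, h₂⟩
    obtain ⟨b, rfl⟩ := h.mem_range a y h₁ h₂
    exact ⟨b, ⟨h₁, h₂⟩, rfl⟩
  · rintro ⟨b, hb, rfl⟩
    exact hb

lemma ReflectsComponents.numComponents_pullback [DecidableEq V] {f : W → V} (hf : Function.Injective f)
    {G : Digraph V} (h : ReflectsComponents f G) :
    numComponents (pullback f G) = (Finset.univ.image fun a => component G (f a)).card := by
  have : (Finset.univ.image fun a => component G (f a)) =
      (components (pullback f G)).image (Finset.image f) := by
    rw [components, Finset.image_image]
    congr 1
    ext1 a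
    rw [← Finset.coe_inj, h.coe_component]
    simp
  rw [this, Finset.card_image_of_injective _ (Finset.image_injective hf), numComponents]

lemma sum_card_components (G : Digraph V) : ∑ C ∈ components G, C.card = Fintype.card V := by
  rw [← Finset.card_biUnion, ← Finset.card_univ]
  · congr 1
    ext v
    simpa using ⟨_, component_mem_components G v, self_mem_component G v⟩
  · intro C hC D hD hne
    refine Finset.disjoint_left.2 ?_
    intro x hx hx'
    exact hne ((eq_component_of_mem hC hx).trans (eq_component_of_mem hD hx').symm)

end Components

/-! ### Digraphs with components in a family -/

section Families

variable {V W : Type*} [LinearOrder V] [LinearOrder W]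

/-- The digraph induced on `C`, with its vertices relabelled in increasing order, is in `A`. -/
def InducedMem (A : Family) (G : Digraph V) (C : Set V) : Prop :=
  ∃ (k : ℕ) (e : Fin k ↪o V), Set.range e = C ∧ pullback e G ∈ A k

/-- The increasing enumeration is the only order embedding of some `Fin k` with range `C`. The
existential form is the one that composes well with order embeddings. -/
lemma inducedMem_iff_inducedOn {A : Family} {n : ℕ} {G : Digraph (Fin n)} {C : Finset (Fin n)} :
    InducedMem A G C ↔ inducedOn G C ∈ A C.card := by
  constructor
  · rintro ⟨k, e, he, hG⟩
    have hk : C.card = k := by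
      rw [← Set.ncard_coe_finset, ← he, ← Set.image_univ,
        Set.ncard_image_of_injective _ e.injective]
      simp
    subst hk
    have : e = C.orderEmbOfFin rfl := Finset.orderEmbOfFin_unique' rfl fun x => by
      rw [← Finset.mem_coe, ← he]; exact ⟨x, rfl⟩
    rw [this] at hG
    exact hG
  · intro h
    exact ⟨C.card, C.orderEmbOfFin rfl, Finset.range_orderEmbOfFin _ _, h⟩

lemma inducedMem_pullback {A : Family} (f : W ↪o V) {G : Digraph V} {C : Set W} :
    InducedMem A (pullback f G) C ↔ InducedMem A G (f '' C) := by
  constructor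
  · rintro ⟨k, e, rfl, h⟩
    exact ⟨k, e.trans f, by rw [← Set.range_comp]; rfl, h⟩
  · rintro ⟨k, e, he, h⟩
    have : ∀ i, ∃ a ∈ C, f a = e i := fun i => by
      have : e i ∈ f '' C := he ▸ ⟨i, rfl⟩
      simpa using this
    choose g hgC hg using this
    refine ⟨k, OrderEmbedding.ofMapLEIff g fun i j => ?_, ?_, ?_⟩
    · rw [← f.le_iff_le, hg, hg, e.le_iff_le]
    · apply f.injective.image_injective
      rw [← he, ← Set.range_comp]
      congr 1
      exact funext hg
    · convert h using 1
      ext i j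
      simp [pullback, hg]

variable [Fintype V] [Fintype W]

/-- Every strongly connected component belongs to `A` after relabelling. -/
def ComponentsIn (A : Family) (G : Digraph V) : Prop :=
  ∀ v, InducedMem A G (component G v)

lemma ReflectsComponents.componentsIn_pullback {A : Family} {f : W ↪o V} {G : Digraph V}
    (h : ReflectsComponents f G) :
    ComponentsIn A (pullback f G) ↔ ∀ a, InducedMem A G (component G (f a)) := by
  simp only [ComponentsIn, inducedMem_pullback, h.coe_component]

/-- Looplessness is automatic: a loop would lie inside a component, and the members of `A` have
none. -/
lemma mem_withComponentsIn_iff {A : Family}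
    (hA : ∀ (n : ℕ), ∀ G ∈ A n, Loopless G ∧ StronglyConnected G) {n : ℕ}
    {G : Digraph (Fin n)} : G ∈ withComponentsIn A n ↔ ComponentsIn A G := by
  constructor
  · intro h v
    exact inducedMem_iff_inducedOn.2 (h.2 _ (component_mem_components G v))
  · intro h
    refine ⟨fun v hv => ?_, fun C hC => ?_⟩
    · obtain ⟨k, e, he, hk⟩ := h v
      have : v ∈ Set.range e := he ▸ self_mem_component G v
      obtain ⟨i, rfl⟩ := this
      exact (hA k _ hk).1 i hv
    · obtain ⟨v, rfl⟩ := exists_component_eq hC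
      exact inducedMem_iff_inducedOn.1 (h v)

end Families

/-! ### Source-like components -/

section Sources

variable {V : Type*}

/-- `S` is a union of source-like components. -/
def IsSourceUnion (G : Digraph V) (S : Finset V) : Prop :=
  ∀ x y, G.Adj x y → y ∈ S → x ∈ S ∧ Reaches G y x

lemma IsSourceUnion.predClosed {G : Digraph V} {S : Finset V} (h : IsSourceUnion G S) :
    PredClosed G S := fun x y hxy hy => (h x y hxy hy).1

lemma IsSourceUnion.mem_of_reaches {G : Digraph V} {S : Finset V} (h : IsSourceUnion G S)
    {x y : V} (hy : y ∈ S) (hxy : Reaches G x y) : x ∈ S ∧ Reaches G y x := by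
  induction hxy using Relation.ReflTransGen.head_induction_on with
  | refl => exact ⟨hy, .refl⟩
  | head hac _ ih =>
    obtain ⟨h₁, h₂⟩ := h _ _ hac ih.1
    exact ⟨h₁, ih.2.trans h₂⟩

variable [Fintype V]

/-- The vertex sets of the source-like components. -/
def sourceComponents (G : Digraph V) : Finset (Finset V) :=
  (components G).filter fun C => PredClosed G C

lemma sourceLikeCount_eq_card (G : Digraph V) :
    sourceLikeCount G = (sourceComponents G).card := by
  have key : ∀ C : {C : Finset V // C ∈ components G},
      IsSource (condensation G) C ↔ PredClosed G (C.1 : Set V) := by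
    rintro ⟨C, hC⟩
    constructor
    -- If `x` were outside `C`, its component would precede `C` in the condensation.
    · intro h x y hxy hy
      by_contra hx
      refine h ⟨component G x, component_mem_components G x⟩ ⟨fun hEq => hx ?_, x,
        self_mem_component G x, y, hy, hxy⟩
      rw [← congrArg Subtype.val hEq]
      exact self_mem_component G x
    · rintro h ⟨D, hD⟩ ⟨hne, x, hx, y, hy, hxy⟩
      exact hne (Subtype.ext ((eq_component_of_mem hD hx).trans
        (eq_component_of_mem hC (h x y hxy hy)).symm))
  rw [sourceLikeCount, Nat.card_congr (Equiv.subtypeEquivRight key), Nat.card_eq_fintype_card,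
    Fintype.card_subtype, sourceComponents, ← Finset.card_map (Function.Embedding.subtype _)]
  congr 1
  ext C
  simp [and_comm]

/-- Expanding the power gives a sum over sets `T` of source-like components. The bijection sends `T`
to its union; the components of the vertices of the union give `T` back. -/
lemma sum_sourceUnion [DecidableEq V] {K : Type*} [CommSemiring K] (G : Digraph V) (t : K) :
    ∑ S ∈ Finset.univ.filter (IsSourceUnion G), t ^ (S.image (component G)).card =
      (1 + t) ^ sourceLikeCount G := by
  rw [sourceLikeCount_eq_card, ← Finset.prod_const, Finset.prod_one_add]
  refine Finset.sum_nbij' (fun S => S.image (component G)) (fun T => T.biUnion id) ?_ ?_ ?_ ?_ ?_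
  · intro S hS
    have hS : IsSourceUnion G S := by simpa using hS
    simp only [Finset.mem_powerset]
    intro C hC
    obtain ⟨v, hv, rfl⟩ := Finset.mem_image.1 hC
    refine Finset.mem_filter.2 ⟨component_mem_components G v, fun x y hxy hy => ?_⟩
    have hy' := mem_component.1 hy
    have : Reaches G x v := .head hxy hy'.2
    exact mem_component.2 ⟨(hS.mem_of_reaches hv this).2, this⟩
  · intro T hT
    simp only [Finset.mem_powerset] at hT
    simp only [Finset.mem_filter, Finset.mem_univ, true_and]
    intro x y hxy hy
    simp only [Finset.mem_biUnion, id] at hy ⊢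
    obtain ⟨C, hC, hyC⟩ := hy
    obtain ⟨h₁, h₂⟩ := Finset.mem_filter.1 (hT hC)
    have hx : x ∈ C := h₂ x y hxy hyC
    refine ⟨⟨C, hC, hx⟩, ?_⟩
    rw [eq_component_of_mem h₁ hyC] at hx
    exact (mem_component.1 hx).1
  · intro S hS
    have hS : IsSourceUnion G S := by simpa using hS
    ext x
    simp only [Finset.mem_biUnion, Finset.mem_image, id, exists_exists_and_eq_and]
    constructor
    · rintro ⟨v, hv, hx⟩
      exact (hS.mem_of_reaches hv (mem_component.1 hx).2).1
    · intro hx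
      exact ⟨x, hx, self_mem_component G x⟩
  · intro T hT
    simp only [Finset.mem_powerset] at hT
    have hT' : ∀ C ∈ T, C ∈ components G := fun C hC => (Finset.mem_filter.1 (hT hC)).1
    ext C
    simp only [Finset.mem_image, Finset.mem_biUnion, id]
    constructor
    · rintro ⟨v, ⟨D, hD, hv⟩, rfl⟩
      rwa [← eq_component_of_mem (hT' D hD) hv]
    · intro hC
      obtain ⟨v, hv⟩ := nonempty_of_mem_components (hT' C hC)
      exact ⟨v, ⟨C, hC, hv⟩, (eq_component_of_mem (hT' C hC) hv).symm⟩
  · intro S _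
    simp

end Sources

/-! ### Edge counts and relabelling -/

section EdgeCount

variable {V W : Type*} [Fintype V] [Fintype W]

lemma edgeCount_eq_sum (G : Digraph V) :
    edgeCount G = ∑ x, ∑ y, if G.Adj x y then 1 else 0 := by
  rw [edgeCount, Finset.card_filter, Fintype.sum_prod_type]

lemma edgeCount_pullback_equiv (e : W ≃ V) (G : Digraph V) :
    edgeCount (pullback e G) = edgeCount G := by
  rw [edgeCount_eq_sum, edgeCount_eq_sum, ← e.sum_comp]
  refine Finset.sum_congr rfl fun x _ => ?_
  rw [← e.sum_comp]
  rfl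

/-- Relabelling of digraphs along a bijection. -/
def pullbackEquiv {V W : Type*} (e : W ≃ V) : Digraph V ≃ Digraph W where
  toFun := pullback e
  invFun := pullback e.symm
  left_inv G := by ext; simp [pullback]
  right_inv G := by ext; simp [pullback]

lemma reflectsComponents_equiv {V W : Type*} (e : W ≃ V) (G : Digraph V) :
    ReflectsComponents e G :=
  PredClosed.reflectsComponents e.injective fun x _ _ _ => e.surjective x

lemma numComponents_pullback_equiv (e : W ≃ V) (G : Digraph V) :
    numComponents (pullback e G) = numComponents G := by
  rw [(reflectsComponents_equiv e G).numComponents_pullback e.injective, numComponents, components]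
  congr 1
  ext C
  simp [e.surjective.exists]

lemma componentsIsolated_pullback_equiv {V W : Type*} (e : W ≃ V) {G : Digraph V} :
    ComponentsIsolated (pullback e G) ↔ ComponentsIsolated G := by
  rw [(reflectsComponents_equiv e G).componentsIsolated_pullback]
  simp [ComponentsIsolated, e.surjective.forall]

lemma componentsIn_pullback_orderIso [LinearOrder V] [LinearOrder W] {A : Family} (e : W ≃o V)
    {G : Digraph V} : ComponentsIn A (pullback e G) ↔ ComponentsIn A G := by
  have := (reflectsComponents_equiv e.toEquiv G).componentsIn_pullback (f := e.toOrderEmbedding)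
    (A := A)
  exact this.trans (by simp [ComponentsIn, e.surjective.forall])

end EdgeCount

/-! ### Splitting a digraph along a set that no edge enters -/

section Join

variable {V : Type*} [DecidableEq V] {S : Finset V}

/-- The digraph with given parts on `S` and on its complement, and given edges from `S` to the
complement. -/
def join [Fintype V] (G : Digraph S) (H : Digraph ↥Sᶜ) (X : Finset (S × ↥Sᶜ)) : Digraph V where
  Adj x y := (∃ a b : S, x = a ∧ y = b ∧ G.Adj a b) ∨
    (∃ a b : ↥Sᶜ, x = a ∧ y = b ∧ H.Adj a b) ∨
    ∃ (a : S) (b : ↥Sᶜ), x = a ∧ y = b ∧ (a, b) ∈ X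

variable [Fintype V] (G : Digraph S) (H : Digraph ↥Sᶜ) (X : Finset (S × ↥Sᶜ))

lemma ne_of_mem_compl (a : S) (b : ↥Sᶜ) : (a : V) ≠ b := fun h =>
  Finset.mem_compl.1 b.2 (h ▸ a.2)

lemma join_adj_left {a b : S} : (join G H X).Adj a b ↔ G.Adj a b := by
  simp only [join, ne_of_mem_compl, false_and, and_false, exists_false, or_false, Subtype.coe_inj]
  simp

lemma join_adj_right {a b : ↥Sᶜ} : (join G H X).Adj a b ↔ H.Adj a b := by
  simp only [join, (ne_of_mem_compl _ _).symm, false_and, and_false, exists_false, or_false,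
    false_or, Subtype.coe_inj]
  simp

lemma join_adj_left_right {a : S} {b : ↥Sᶜ} : (join G H X).Adj a b ↔ (a, b) ∈ X := by
  simp only [join, ne_of_mem_compl, (ne_of_mem_compl _ _).symm, false_and, and_false,
    exists_false, false_or, Subtype.coe_inj]
  simp

lemma not_join_adj_right_left {a : S} {b : ↥Sᶜ} : ¬ (join G H X).Adj b a := by
  simp only [join, ne_of_mem_compl, (ne_of_mem_compl _ _).symm, false_and, and_false,
    exists_false, false_or, not_false_eq_true]

lemma forall_iff_compl (S : Finset V) {p : V → Prop} :
    (∀ x, p x) ↔ (∀ a : S, p a) ∧ ∀ b : ↥Sᶜ, p b := by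
  refine ⟨fun h => ⟨fun a => h a, fun b => h b⟩, fun h x => ?_⟩
  by_cases hx : x ∈ S
  · exact h.1 ⟨x, hx⟩
  · exact h.2 ⟨x, Finset.mem_compl.2 hx⟩

lemma sum_eq_sum_add_sum_compl {M : Type*} [AddCommMonoid M] (S : Finset V) (f : V → M) :
    ∑ x, f x = ∑ a : S, f a + ∑ b : ↥Sᶜ, f b := by
  rw [Finset.sum_coe_sort S f, Finset.sum_coe_sort Sᶜ f, Finset.sum_add_sum_compl]

lemma predClosed_join : PredClosed (join G H X) S := by
  intro x y hxy hy
  by_contra hx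
  exact not_join_adj_right_left G H X (a := ⟨y, hy⟩) (b := ⟨x, Finset.mem_compl.2 hx⟩) hxy

lemma pullback_join_left : pullback ((↑) : S → V) (join G H X) = G := by
  ext a b
  exact join_adj_left G H X

lemma pullback_join_right : pullback ((↑) : ↥Sᶜ → V) (join G H X) = H := by
  ext a b
  exact join_adj_right G H X

lemma edgeCount_join : edgeCount (join G H X) = edgeCount G + edgeCount H + X.card := by
  have hX : X.card = ∑ a, ∑ b, if (a, b) ∈ X then 1 else 0 := by
    rw [← Fintype.sum_prod_type' (f := fun a b => if (a, b) ∈ X then 1 else 0)]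
    simp
  simp only [edgeCount_eq_sum, sum_eq_sum_add_sum_compl S, join_adj_left, join_adj_right,
    join_adj_left_right, not_join_adj_right_left, hX, Finset.sum_add_distrib]
  simp only [if_false, Finset.sum_const_zero]
  ring

lemma join_pullback {G : Digraph V} (h : PredClosed G S) :
    join (pullback ((↑) : S → V) G) (pullback ((↑) : ↥Sᶜ → V) G)
      (Finset.univ.filter fun p => G.Adj p.1 p.2) = G := by
  have : ∀ (a : S) (b : ↥Sᶜ), ¬ G.Adj b a := fun a b hab =>
    Finset.mem_compl.1 b.2 (h _ _ hab a.2)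
  have key : ∀ x y, (join (pullback ((↑) : S → V) G) (pullback ((↑) : ↥Sᶜ → V) G)
      (Finset.univ.filter fun p => G.Adj p.1 p.2)).Adj x y ↔ G.Adj x y := by
    simp only [forall_iff_compl S, join_adj_left, join_adj_right, join_adj_left_right,
      not_join_adj_right_left, this]
    simp [pullback]
  ext x y
  exact key x y

/-- A sum over the digraphs without edges into `S` splits according to the two induced parts and
the edges between them. -/
lemma sum_predClosed {M : Type*} [AddCommMonoid M] (S : Finset V) (F : Digraph V → M) :
    ∑ G ∈ Finset.univ.filter (fun G : Digraph V => PredClosed G S), F G =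
      ∑ G : Digraph S, ∑ H : Digraph ↥Sᶜ, ∑ X : Finset (S × ↥Sᶜ), F (join G H X) := by
  simp only [← Fintype.sum_prod_type']
  refine Finset.sum_bij' (fun G _ => (pullback ((↑) : S → V) G, pullback ((↑) : ↥Sᶜ → V) G,
      Finset.univ.filter fun p => G.Adj p.1 p.2)) (fun p _ => join p.1 p.2.1 p.2.2) ?_ ?_ ?_ ?_ ?_
  · simp
  · intro p _
    simp [predClosed_join]
  · intro G hG
    exact join_pullback (by simpa using hG)
  · rintro ⟨G, H, X⟩ _
    simp [pullback_join_left, pullback_join_right, join_adj_left_right]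
  · intro G hG
    rw [join_pullback (by simpa using hG)]

lemma reflectsComponents_join_left : ReflectsComponents ((↑) : S → V) (join G H X) :=
  PredClosed.reflectsComponents Subtype.val_injective
    (by simpa using predClosed_join G H X)

/-- The complement of a set that no edge enters is a set that no edge leaves. -/
lemma reflectsComponents_join_right : ReflectsComponents ((↑) : ↥Sᶜ → V) (join G H X) := by
  refine SuccClosed.reflectsComponents Subtype.val_injective fun x y hxy hx => ?_
  have := predClosed_join G H X x y hxy
  simp at this hx ⊢
  tauto

lemma componentsIn_join {V : Type*} [LinearOrder V] [Fintype V] {S : Finset V} (G : Digraph S)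
    (H : Digraph ↥Sᶜ) (X : Finset (S × ↥Sᶜ)) {A : Family} :
    ComponentsIn A (join G H X) ↔ ComponentsIn A G ∧ ComponentsIn A H := by
  have h₁ := (reflectsComponents_join_left G H X).componentsIn_pullback
    (f := OrderEmbedding.subtype (· ∈ S)) (A := A)
  have h₂ := (reflectsComponents_join_right G H X).componentsIn_pullback
    (f := OrderEmbedding.subtype (· ∈ Sᶜ)) (A := A)
  simp only [OrderEmbedding.coe_subtype] at h₁ h₂
  erw [pullback_join_left] at h₁
  erw [pullback_join_right] at h₂
  rw [h₁, h₂, ComponentsIn, forall_iff_compl S]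

lemma isSourceUnion_join : IsSourceUnion (join G H X) S ↔ ComponentsIsolated G := by
  have h := (reflectsComponents_join_left G H X).componentsIsolated_pullback
  rw [pullback_join_left] at h
  rw [h]
  constructor
  · intro h a b hab
    exact (h _ _ hab b.2).2
  · intro h x y hxy hy
    have hx := predClosed_join G H X x y hxy hy
    exact ⟨hx, h ⟨x, hx⟩ ⟨y, hy⟩ hxy⟩

lemma card_image_component_join :
    (S.image (component (join G H X))).card = numComponents G := by
  have h := (reflectsComponents_join_left G H X).numComponents_pullback Subtype.val_injective
  rw [pullback_join_left] at h
  rw [h]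
  congr 1
  ext C
  simp

lemma numComponents_join :
    numComponents (join G H X) = numComponents G + numComponents H := by
  have h₁ := (reflectsComponents_join_left G H X).numComponents_pullback Subtype.val_injective
  have h₂ := (reflectsComponents_join_right G H X).numComponents_pullback Subtype.val_injective
  rw [pullback_join_left] at h₁
  rw [pullback_join_right] at h₂
  rw [h₁, h₂, ← Finset.card_union_of_disjoint, numComponents, components]
  · congr 1
    ext C
    simp only [Finset.mem_image, Finset.mem_univ, true_and, Finset.mem_union]
    simpa [not_and, imp_iff_not_or] using
      not_congr (forall_iff_compl S (p := fun v => component (join G H X) v ≠ C))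
  -- A component meeting both sides would contain a path from the complement back into `S`.
  · rw [Finset.disjoint_left]
    intro C hC hC'
    obtain ⟨a, -, rfl⟩ := Finset.mem_image.1 hC
    obtain ⟨b, -, hb⟩ := Finset.mem_image.1 hC'
    obtain ⟨c, hc, -⟩ := PredClosed.exists_reaches (f := ((↑) : S → V))
      (by simpa using predClosed_join G H X)
      (mem_component.1 (hb ▸ self_mem_component (join G H X) b)).2
    exact ne_of_mem_compl c b hc

/-- An edge of `X` joins different components, because nothing leads back from the complement to
`S`. -/
lemma componentsIsolated_join :
    ComponentsIsolated (join G H X) ↔ ComponentsIsolated G ∧ ComponentsIsolated H ∧ X = ∅ := by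
  have h₁ := (reflectsComponents_join_left G H X).componentsIsolated_pullback
  have h₂ := (reflectsComponents_join_right G H X).componentsIsolated_pullback
  rw [pullback_join_left] at h₁
  rw [pullback_join_right] at h₂
  have h₃ : ∀ (a : S) (b : ↥Sᶜ), ¬ Reaches (join G H X) b a := by
    intro a b h
    obtain ⟨c, hc, -⟩ := PredClosed.exists_reaches (f := ((↑) : S → V))
      (by simpa using predClosed_join G H X) h
    exact ne_of_mem_compl c b hc
  rw [h₁, h₂, ComponentsIsolated]
  simp only [forall_iff_compl S, not_join_adj_right_left, h₃, join_adj_left_right,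
    Finset.eq_empty_iff_forall_notMem, Prod.forall]
  constructor
  · rintro ⟨h, h'⟩
    exact ⟨fun a b => (h a).1 b, fun a b => (h' a).2 b, fun a b => (h a).2 b⟩
  · rintro ⟨h, h', h''⟩
    exact ⟨fun a => ⟨fun b => h a b, fun b => h'' a b⟩, fun a => ⟨fun b => by simp, fun b => h' a b⟩⟩

end Join

/-! ### Strongly connected digraphs as single components -/

section Connected

variable {V : Type*} [Fintype V]

lemma StronglyConnected.component_eq {G : Digraph V} (h : StronglyConnected G) (v : V) :
    component G v = Finset.univ := by
  ext x
  simp [mem_component, h.2]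

lemma StronglyConnected.numComponents_eq_one {G : Digraph V} (h : StronglyConnected G) :
    numComponents G = 1 := by
  obtain ⟨v⟩ := h.1
  rw [numComponents, Finset.card_eq_one]
  refine ⟨Finset.univ, ?_⟩
  ext C
  rw [Finset.mem_singleton]
  constructor
  · intro hC
    obtain ⟨x, rfl⟩ := exists_component_eq hC
    exact h.component_eq x
  · rintro rfl
    exact h.component_eq v ▸ component_mem_components G v

/-- The components of the join that meet `S` are those of `G`, so `S` is one of them exactly when
`G` has a single component. -/
lemma mem_components_join [DecidableEq V] {S : Finset V} {G : Digraph S} {H : Digraph ↥Sᶜ}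
    {X : Finset (S × ↥Sᶜ)} : S ∈ components (join G H X) ↔ StronglyConnected G := by
  have h := reflectsComponents_join_left G H X
  have hS : ∀ a : S, component (join G H X) a = S ↔ component G a = Finset.univ := by
    intro a
    rw [← Finset.coe_inj, h.coe_component, pullback_join_left, ← Finset.coe_inj,
      ← Subtype.val_injective.image_injective.eq_iff]
    simp
  constructor
  · intro hC
    obtain ⟨v, hv⟩ := nonempty_of_mem_components hC
    refine ⟨⟨v, hv⟩, fun a b => ?_⟩
    have := (hS a).1 (eq_component_of_mem hC a.2).symm
    exact (mem_component.1 (this ▸ Finset.mem_univ b : b ∈ component G a)).1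
  · intro hG
    obtain ⟨a⟩ := hG.1
    have := component_mem_components (join G H X) a
    rwa [(hS a).2 (hG.component_eq a)] at this

lemma inducedMem_univ_iff [LinearOrder V] {A : Family}
    (hA : ∀ (n : ℕ), ∀ G ∈ A n, Loopless G ∧ StronglyConnected G) {G : Digraph V} :
    InducedMem A G Set.univ ↔ ComponentsIn A G ∧ StronglyConnected G := by
  constructor
  · intro h
    have hG : StronglyConnected G := by
      obtain ⟨k, e, he, hk⟩ := h
      obtain ⟨⟨i⟩, hr⟩ := (hA k _ hk).2
      refine ⟨⟨e i⟩, fun x y => ?_⟩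
      obtain ⟨i, rfl⟩ : x ∈ Set.range e := he ▸ trivial
      obtain ⟨j, rfl⟩ : y ∈ Set.range e := he ▸ trivial
      exact (hr i j).of_pullback
    refine ⟨fun v => ?_, hG⟩
    rwa [hG.component_eq, Finset.coe_univ]
  · rintro ⟨h, hG⟩
    obtain ⟨v⟩ := hG.1
    have := h v
    rwa [hG.component_eq, Finset.coe_univ] at this

end Connected

/-! ### Weighted enumeration -/

section Weights

variable {K : Type*} [Field K] (w t : K) (A : Family)

/-- The weighted count of the digraphs on `V` with components in `A`. -/
def componentsInWeight (V : Type*) [LinearOrder V] [Fintype V] : K :=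
  ∑ G : Digraph V, if ComponentsIn A G then w ^ edgeCount G else 0

/-- The weighted count of the disjoint unions of digraphs from `A` on `V`, with `t` marking the
components. -/
def isolatedWeight (V : Type*) [LinearOrder V] [Fintype V] : K :=
  ∑ G : Digraph V, if ComponentsIn A G ∧ ComponentsIsolated G then
    w ^ edgeCount G * t ^ numComponents G else 0

variable {V W : Type*} [LinearOrder V] [Fintype V] [LinearOrder W] [Fintype W]

lemma componentsInWeight_congr (e : W ≃o V) :
    componentsInWeight w A W = componentsInWeight w A V := by
  rw [componentsInWeight, ← (pullbackEquiv e.toEquiv).sum_comp, componentsInWeight]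
  refine Finset.sum_congr rfl fun G _ => ?_
  have h₁ := componentsIn_pullback_orderIso (A := A) e (G := G)
  have h₂ := edgeCount_pullback_equiv e.toEquiv G
  exact if_congr h₁ (congrArg (w ^ ·) h₂) rfl

lemma isolatedWeight_congr (e : W ≃o V) :
    isolatedWeight w t A W = isolatedWeight w t A V := by
  rw [isolatedWeight, ← (pullbackEquiv e.toEquiv).sum_comp, isolatedWeight]
  refine Finset.sum_congr rfl fun G _ => ?_
  have h₁ := componentsIn_pullback_orderIso (A := A) e (G := G)
  have h₂ := edgeCount_pullback_equiv e.toEquiv G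
  have h₃ := componentsIsolated_pullback_equiv e.toEquiv (G := G)
  have h₄ := numComponents_pullback_equiv e.toEquiv G
  exact if_congr (and_congr h₁ h₃) (congrArg₂ (w ^ · * t ^ ·) h₂ h₄) rfl

lemma componentsInWeight_eq_fin :
    componentsInWeight w A V = componentsInWeight w A (Fin (Fintype.card V)) :=
  (componentsInWeight_congr w A (Fintype.orderIsoFinOfCardEq V rfl)).symm

lemma isolatedWeight_eq_fin :
    isolatedWeight w t A V = isolatedWeight w t A (Fin (Fintype.card V)) :=
  (isolatedWeight_congr w t A (Fintype.orderIsoFinOfCardEq V rfl)).symm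

lemma inducedMem_univ_fin {n : ℕ} {G : Digraph (Fin n)} :
    InducedMem A G Set.univ ↔ G ∈ A n := by
  constructor
  · rintro ⟨k, e, he, hk⟩
    obtain rfl : k = n := by
      simpa using Fintype.card_congr (Equiv.ofBijective e ⟨e.injective, Set.range_eq_univ.1 he⟩)
    -- The identity is the only order embedding of `Fin k` into itself, so no invariance of `A`
    -- under relabelling is needed.
    have : e = RelEmbedding.refl _ := by
      have h₁ := Finset.orderEmbOfFin_unique' (s := Finset.univ) (Finset.card_fin k) (f := e)
        (by simp)
      have h₂ := Finset.orderEmbOfFin_unique' (s := Finset.univ) (Finset.card_fin k)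
        (f := RelEmbedding.refl _) (by simp)
      rw [h₁, ← h₂]
    rw [this] at hk
    exact hk
  · intro h
    exact ⟨n, RelEmbedding.refl _, by simp, h⟩

lemma sum_inducedMem_univ :
    (∑ G : Digraph V, if InducedMem A G Set.univ then w ^ edgeCount G else 0) =
      weightSeq w A (Fintype.card V) := by
  set e := Fintype.orderIsoFinOfCardEq V rfl
  rw [← (pullbackEquiv e.symm.toEquiv).sum_comp, weightSeq, Finset.sum_filter]
  refine Finset.sum_congr (by congr) fun G _ => ?_
  have h₁ := inducedMem_pullback (A := A) e.symm.toOrderEmbedding (G := G) (C := Set.univ)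
  have h₂ := edgeCount_pullback_equiv e.symm.toEquiv G
  have h₃ : e.symm.toOrderEmbedding '' Set.univ = Set.univ := by
    simp
  rw [h₃, inducedMem_univ_fin] at h₁
  exact if_congr h₁ (congrArg (w ^ ·) h₂) rfl

lemma sum_pow_card (ι : Type*) [Fintype ι] :
    ∑ X : Finset ι, w ^ X.card = (1 + w) ^ Fintype.card ι := by
  simpa [add_comm] using Fintype.sum_pow_mul_eq_add_pow ι w 1

/-- Marking some of the source-like components amounts to choosing their union `S`, the parts on `S`
and on its complement, and the edges from `S` to the complement. -/
lemma sum_marked_eq :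
    (∑ G : Digraph V, if ComponentsIn A G then
        w ^ edgeCount G * (1 + t) ^ sourceLikeCount G else 0) =
      ∑ S : Finset V, (1 + w) ^ (S.card * Sᶜ.card) *
        (isolatedWeight w t A S * componentsInWeight w A ↥Sᶜ) := by
  have h : ∀ G : Digraph V, (if ComponentsIn A G then
        w ^ edgeCount G * (1 + t) ^ sourceLikeCount G else 0) =
      ∑ S : Finset V, if ComponentsIn A G ∧ IsSourceUnion G S then
        w ^ edgeCount G * t ^ (S.image (component G)).card else 0 := by
    intro G
    split_ifs with hG
    · simp only [hG, true_and]
      rw [← sum_sourceUnion, Finset.mul_sum, Finset.sum_filter]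
    · simp [hG]
  rw [Finset.sum_congr rfl fun G _ => h G, Finset.sum_comm]
  refine Finset.sum_congr rfl fun S _ => ?_
  -- No edge enters a union of source-like components, so only digraphs that split along `S`
  -- contribute.
  have h' : (∑ G : Digraph V, if ComponentsIn A G ∧ IsSourceUnion G S then
        w ^ edgeCount G * t ^ (S.image (component G)).card else 0) =
      ∑ G ∈ Finset.univ.filter (fun G : Digraph V => PredClosed G S),
        if ComponentsIn A G ∧ IsSourceUnion G S then
          w ^ edgeCount G * t ^ (S.image (component G)).card else 0 := by
    refine (Finset.sum_subset (Finset.filter_subset _ _) fun G _ hG => if_neg fun h => hG ?_).symm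
    simpa using h.2.predClosed
  rw [h', sum_predClosed, isolatedWeight, componentsInWeight, Finset.sum_mul_sum, Finset.mul_sum]
  refine Finset.sum_congr rfl fun G _ => ?_
  rw [Finset.mul_sum]
  refine Finset.sum_congr rfl fun H _ => ?_
  simp only [componentsIn_join, isSourceUnion_join, card_image_component_join, edgeCount_join]
  have hX : (1 + w) ^ (S.card * Sᶜ.card) = ∑ X : Finset (S × ↥Sᶜ), w ^ X.card := by
    rw [sum_pow_card, Fintype.card_prod, Fintype.card_coe, Fintype.card_coe]
  rw [hX, Finset.sum_mul]
  refine Finset.sum_congr rfl fun X _ => ?_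
  by_cases h₁ : ComponentsIn A G <;> by_cases h₂ : ComponentsIn A H <;>
    by_cases h₃ : ComponentsIsolated G <;> simp [h₁, h₂, h₃]
  ring

/-- Marking a vertex, and removing its component. -/
lemma card_mul_isolatedWeight
    (hA : ∀ (n : ℕ), ∀ G ∈ A n, Loopless G ∧ StronglyConnected G) :
    (Fintype.card V : K) * isolatedWeight w t A V =
      ∑ S : Finset V, (S.card : K) *
        (t * weightSeq w A S.card * isolatedWeight w t A ↥Sᶜ) := by
  have h : ∀ G : Digraph V, (Fintype.card V : K) * (if ComponentsIn A G ∧ ComponentsIsolated G then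
        w ^ edgeCount G * t ^ numComponents G else 0) =
      ∑ S : Finset V, if (ComponentsIn A G ∧ ComponentsIsolated G) ∧ S ∈ components G then
        (S.card : K) * (w ^ edgeCount G * t ^ numComponents G) else 0 := by
    intro G
    split_ifs with hG
    · simp only [hG, true_and]
      -- A marked vertex is a component `S` together with one of its `S.card` vertices.
      rw [← sum_card_components G, Nat.cast_sum, Finset.sum_mul, ← Finset.sum_filter]
      simp
    · simp [hG]
  rw [isolatedWeight, Finset.mul_sum, Finset.sum_congr rfl fun G _ => h G, Finset.sum_comm]
  refine Finset.sum_congr rfl fun S _ => ?_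
  have h' : (∑ G : Digraph V,
        if (ComponentsIn A G ∧ ComponentsIsolated G) ∧ S ∈ components G then
          (S.card : K) * (w ^ edgeCount G * t ^ numComponents G) else 0) =
      ∑ G ∈ Finset.univ.filter (fun G : Digraph V => PredClosed G S),
        if (ComponentsIn A G ∧ ComponentsIsolated G) ∧ S ∈ components G then
          (S.card : K) * (w ^ edgeCount G * t ^ numComponents G) else 0 := by
    refine (Finset.sum_subset (Finset.filter_subset _ _) fun G _ hG => if_neg fun h => hG ?_).symm
    simp only [Finset.mem_filter, Finset.mem_univ, true_and]
    intro x y hxy hy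
    have := eq_component_of_mem h.2 hy
    rw [Finset.mem_coe, this, mem_component]
    exact ⟨h.1.2 _ _ hxy, .single hxy⟩
  have hS : weightSeq w A S.card = ∑ G : Digraph S,
      if InducedMem A G Set.univ then w ^ edgeCount G else 0 := by
    rw [← Fintype.card_coe S, ← sum_inducedMem_univ]
    congr!
  rw [h', sum_predClosed, isolatedWeight, hS, mul_assoc t, Finset.sum_mul_sum,
    Finset.mul_sum, Finset.mul_sum]
  refine Finset.sum_congr rfl fun G _ => ?_
  rw [Finset.mul_sum, Finset.mul_sum]
  refine Finset.sum_congr rfl fun H _ => ?_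
  -- Isolation of the components forbids edges between `S` and its complement.
  rw [Finset.sum_eq_single ∅]
  · simp only [componentsIn_join, componentsIsolated_join, mem_components_join, edgeCount_join,
      numComponents_join, inducedMem_univ_iff hA]
    by_cases hG : StronglyConnected G
    · have : ComponentsIsolated G := fun x y _ => hG.2 y x
      by_cases h₁ : ComponentsIn A G <;> by_cases h₂ : ComponentsIn A H <;>
        by_cases h₃ : ComponentsIsolated H <;>
        simp [h₁, h₂, h₃, hG, this, hG.numComponents_eq_one]
      exact Or.inl (by ring)
    · simp [hG]
  · intro X _ hX
    simp [componentsIsolated_join, hX]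
  · simp

end Weights

/-! ### Exponentials and Hadamard products of power series -/

section Series

variable {K : Type*} [Field K]

lemma coeff_egf (a : ℕ → K) (n : ℕ) : PowerSeries.coeff n (egf a) = a n / (n ! : K) :=
  PowerSeries.coeff_mk _ _

lemma coeff_ggf (w : K) (a : ℕ → K) (n : ℕ) :
    PowerSeries.coeff n (ggf w a) = a n / (1 + w) ^ n.choose 2 / (n ! : K) :=
  PowerSeries.coeff_mk _ _

lemma C_mul_egf (t : K) (a : ℕ → K) : PowerSeries.C t * egf a = egf fun n => t * a n := by
  ext n
  rw [PowerSeries.coeff_C_mul, coeff_egf, coeff_egf, mul_div_assoc]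

/-- Pairs from a set cut into blocks of sizes `i` and `j` either cross the cut or lie in one block.
-/
lemma add_choose_two (i j : ℕ) :
    (i + j).choose 2 = i * j + i.choose 2 + j.choose 2 := by
  induction j with
  | zero => simp
  | succ j ih =>
    rw [← add_assoc, Nat.choose_succ_succ' (i + j) 1, Nat.choose_succ_succ' j 1, ih]
    simp
    ring

variable [CharZero K]

/-- The equation determines the coefficient of degree `n + 1` from the lower ones, as `n + 1` is
invertible in characteristic zero. -/
lemma eq_of_derivative_eq_mul {P Q F : PowerSeries K}
    (hP : PowerSeries.derivative K P = P * F) (hQ : PowerSeries.derivative K Q = Q * F)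
    (h₀ : PowerSeries.coeff 0 P = PowerSeries.coeff 0 Q) : P = Q := by
  ext n
  induction n using Nat.strong_induction_on with
  | _ n ih =>
    cases n with
    | zero => exact h₀
    | succ n =>
      have h₁ := congrArg (PowerSeries.coeff n) hP
      have h₂ := congrArg (PowerSeries.coeff n) hQ
      rw [PowerSeries.coeff_derivative, PowerSeries.coeff_mul] at h₁ h₂
      have : (n + 1 : K) ≠ 0 := Nat.cast_add_one_ne_zero n
      apply mul_right_cancel₀ this
      rw [h₁, h₂]
      refine Finset.sum_congr rfl fun p hp => ?_
      have := Finset.HasAntidiagonal.mem_antidiagonal.1 hp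
      rw [ih p.1 (by omega)]

lemma cast_factorial_ne_zero (n : ℕ) : (n ! : K) ≠ 0 := Nat.cast_ne_zero.2 n.factorial_ne_zero

lemma derivative_egf {a p : ℕ → K}
    (h : ∀ n : ℕ, (n : K) * p n =
      ∑ k ∈ Finset.range (n + 1), n.choose k • ((k : K) * (a k * p (n - k)))) :
    PowerSeries.derivative K (egf p) = egf p * PowerSeries.derivative K (egf a) := by
  ext n
  rw [PowerSeries.coeff_derivative, mul_comm (egf p), PowerSeries.coeff_mul,
    Finset.Nat.sum_antidiagonal_eq_sum_range_succ_mk]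
  simp only [PowerSeries.coeff_derivative, coeff_egf]
  have h' := h (n + 1)
  -- The term `k = 0` vanishes through its factor `k`; the shift of the others matches the
  -- derivative of `egf a`.
  rw [Finset.sum_range_succ'] at h'
  simp only [Nat.cast_zero, zero_mul, smul_zero, add_zero, Nat.add_sub_add_right] at h'
  push_cast at h'
  rw [div_mul_eq_mul_div, mul_comm, h', Finset.sum_div]
  refine Finset.sum_congr rfl fun k hk => ?_
  have hk : k ≤ n := Nat.lt_succ_iff.1 (Finset.mem_range.1 hk)
  rw [nsmul_eq_mul, Nat.cast_choose K (Nat.succ_le_succ hk), Nat.succ_sub_succ]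
  have h₁ := cast_factorial_ne_zero (K := K) (n + 1)
  have h₂ := cast_factorial_ne_zero (K := K) (k + 1)
  have h₃ := cast_factorial_ne_zero (K := K) (n - k)
  field_simp

/-- Both sides solve `P' = P * (egf a)'` with constant term `1`; the recurrence is this equation
read coefficientwise. -/
lemma expSeries_egf [Algebra ℚ K] {a p : ℕ → K} (ha : a 0 = 0) (hp : p 0 = 1)
    (h : ∀ n : ℕ, (n : K) * p n =
      ∑ k ∈ Finset.range (n + 1), n.choose k • ((k : K) * (a k * p (n - k)))) :
    expSeries (egf a) = egf p := by
  have ha' : PowerSeries.constantCoeff (egf a) = 0 := by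
    rw [← PowerSeries.coeff_zero_eq_constantCoeff_apply, coeff_egf, ha, zero_div]
  have hs := PowerSeries.HasSubst.of_constantCoeff_zero' ha'
  refine eq_of_derivative_eq_mul (F := PowerSeries.derivative K (egf a)) ?_ (derivative_egf h) ?_
  · rw [expSeries, PowerSeries.derivative_subst hs, PowerSeries.derivative_exp]
  · rw [coeff_egf, hp, expSeries, PowerSeries.coeff_subst' hs, finsum_eq_single _ 0]
    · simp
    · intro d hd
      simp [ha', hd]

/-- The crossing factor `(1 + w) ^ (k * (n - k))` cancels, leaving one graphic denominator for each
block; the Hadamard product with `Set` supplies the one for `p`. -/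
lemma ggf_eq_expHadamard_mul {w : K} (hw : 1 + w ≠ 0) {m p d : ℕ → K}
    (h : ∀ n, m n = ∑ k ∈ Finset.range (n + 1),
      n.choose k • ((1 + w) ^ (k * (n - k)) * (p k * d (n - k)))) :
    ggf w m = expHadamard (ggf w fun _ => 1) (egf p) * ggf w d := by
  ext n
  rw [PowerSeries.coeff_mul, Finset.Nat.sum_antidiagonal_eq_sum_range_succ_mk, coeff_ggf, h,
    Finset.sum_div, Finset.sum_div]
  refine Finset.sum_congr rfl fun k hk => ?_
  obtain ⟨j, rfl⟩ := Nat.exists_eq_add_of_le (Nat.lt_succ_iff.1 (Finset.mem_range.1 hk))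
  simp only [expHadamard, coeff_egf, coeff_ggf, Nat.add_sub_cancel_left, nsmul_eq_mul]
  rw [Nat.cast_choose K (Nat.le_add_right k j), Nat.add_sub_cancel_left, add_choose_two, pow_add,
    pow_add]
  have h₁ := cast_factorial_ne_zero (K := K) (k + j)
  have h₂ := cast_factorial_ne_zero (K := K) k
  have h₃ := cast_factorial_ne_zero (K := K) j
  field_simp

end Series

/-! ### Generating functions of families -/

section GeneratingFunctions

/-- Take a vertex `v` reached from the fewest vertices. Any predecessor `x` of its component is
reached from no fewer, hence from the same ones, among them `v`. -/
lemma sourceLikeCount_ne_zero {V : Type*} [Fintype V] [Nonempty V] (G : Digraph V) :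
    sourceLikeCount G ≠ 0 := by
  obtain ⟨v, hv⟩ := Finite.exists_min fun v => (Finset.univ.filter fun x => Reaches G x v).card
  rw [sourceLikeCount_eq_card]
  refine Finset.card_ne_zero_of_mem (a := component G v)
    (Finset.mem_filter.2 ⟨component_mem_components G v, fun x y hxy hy => ?_⟩)
  have hx : Reaches G x v := .head hxy (mem_component.1 hy).2
  have hsub : (Finset.univ.filter fun z => Reaches G z x) ⊆
      Finset.univ.filter fun z => Reaches G z v := by
    intro z hz
    simp only [Finset.mem_filter, Finset.mem_univ, true_and] at hz ⊢
    exact hz.trans hx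
  have hEq := Finset.eq_of_subset_of_card_le hsub (hv x)
  have : v ∈ Finset.univ.filter fun z => Reaches G z x := by
    rw [hEq]
    exact Finset.mem_filter.2 ⟨Finset.mem_univ v, .refl⟩
  exact mem_component.2 ⟨by simpa using this, hx⟩

variable {K : Type*} [Field K] {w t : K} {A : Family}

lemma weightSeq_edgeless (w : K) (n : ℕ) : weightSeq w edgeless n = 1 := by
  have : edgeCount (⊥ : Digraph (Fin n)) = 0 := by simp [edgeCount]
  rw [weightSeq, Finset.sum_filter, Finset.sum_eq_single ⊥]
  · simp [edgeless, this]
  · intro G _ hG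
    exact if_neg hG
  · simp

lemma isolatedWeight_fin_zero : isolatedWeight w t A (Fin 0) = 1 := by
  have h (G : Digraph (Fin 0)) : ComponentsIn A G ∧ ComponentsIsolated G ∧ edgeCount G = 0 ∧
      numComponents G = 0 :=
    ⟨fun v => v.elim0, fun v => v.elim0, by simp [edgeCount], by simp [numComponents, components]⟩
  rw [isolatedWeight, Fintype.sum_unique]
  obtain ⟨h₁, h₂, h₃, h₄⟩ := h default
  rw [if_pos ⟨h₁, h₂⟩, h₃, h₄, pow_zero, pow_zero, one_mul]

lemma isolatedWeight_coe {n : ℕ} (S : Finset (Fin n)) :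
    isolatedWeight w t A S = isolatedWeight w t A (Fin S.card) := by
  rw [isolatedWeight_eq_fin, Fintype.card_coe]

lemma isolatedWeight_compl {n : ℕ} (S : Finset (Fin n)) :
    isolatedWeight w t A ↥Sᶜ = isolatedWeight w t A (Fin (n - S.card)) := by
  rw [isolatedWeight_eq_fin, Fintype.card_coe, Finset.card_compl, Fintype.card_fin]

lemma componentsInWeight_compl {n : ℕ} (S : Finset (Fin n)) :
    componentsInWeight w A ↥Sᶜ = componentsInWeight w A (Fin (n - S.card)) := by
  rw [componentsInWeight_eq_fin, Fintype.card_coe, Finset.card_compl, Fintype.card_fin]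

lemma sum_finset_fin_eq {M : Type*} [AddCommMonoid M] {n : ℕ} {g : Finset (Fin n) → M}
    {f : ℕ → M} (h : ∀ S, g S = f S.card) :
    ∑ S, g S = ∑ k ∈ Finset.range (n + 1), n.choose k • f k := by
  rw [Finset.sum_congr rfl fun S _ => h S, ← Finset.powerset_univ,
    Finset.sum_powerset_apply_card, Finset.card_fin]

variable (hA : ∀ (n : ℕ), ∀ G ∈ A n, Loopless G ∧ StronglyConnected G)

include hA

lemma weightSeq_zero : weightSeq w A 0 = 0 := by
  rw [weightSeq, Finset.sum_filter]
  refine Finset.sum_eq_zero fun G _ => if_neg fun h => ?_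
  obtain ⟨i⟩ := (hA 0 G h).2.1
  exact i.elim0

lemma weightSeq_withComponentsIn (n : ℕ) :
    weightSeq w (withComponentsIn A) n = componentsInWeight w A (Fin n) := by
  rw [weightSeq, Finset.sum_filter, componentsInWeight]
  simp only [mem_withComponentsIn_iff hA]

lemma weightSeqMarked_withComponentsIn (n : ℕ) :
    weightSeqMarked w (1 + t) (withComponentsIn A) n =
      ∑ k ∈ Finset.range (n + 1), n.choose k • ((1 + w) ^ (k * (n - k)) *
        (isolatedWeight w t A (Fin k) * weightSeq w (withComponentsIn A) (n - k))) := by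
  have h := (sum_marked_eq w t A (V := Fin n)).trans <| sum_finset_fin_eq
    (f := fun k => (1 + w) ^ (k * (n - k)) *
      (isolatedWeight w t A (Fin k) * weightSeq w (withComponentsIn A) (n - k))) fun S => by
    rw [isolatedWeight_coe, componentsInWeight_compl, weightSeq_withComponentsIn hA,
      Finset.card_compl, Fintype.card_fin]
  rw [← h, weightSeqMarked, Finset.sum_filter]
  simp only [mem_withComponentsIn_iff hA]

variable [CharZero K]

lemma expSeries_eq_egf_isolatedWeight [Algebra ℚ K] (w t : K) :
    expSeries (PowerSeries.C t * egf (weightSeq w A)) =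
      egf fun n => isolatedWeight w t A (Fin n) := by
  rw [C_mul_egf]
  refine expSeries_egf (by rw [weightSeq_zero hA, mul_zero]) isolatedWeight_fin_zero fun n => ?_
  have h := (card_mul_isolatedWeight w t A (V := Fin n) hA).trans <| sum_finset_fin_eq
    (f := fun k : ℕ => (k : K) * (t * weightSeq w A k * isolatedWeight w t A (Fin (n - k))))
    fun S => by rw [isolatedWeight_compl]
  rwa [Fintype.card_fin] at h

/-- The generating function of the digraphs with components in `A`, where `1 + t` marks the
source-like components. -/
theorem ggf_weightSeqMarked [Algebra ℚ K] (hw : 1 + w ≠ 0) (t : K) :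
    ggf w (weightSeqMarked w (1 + t) (withComponentsIn A)) =
      expHadamard (ggf w (weightSeq w edgeless))
        (expSeries (PowerSeries.C t * egf (weightSeq w A))) *
        ggf w (weightSeq w (withComponentsIn A)) := by
  rw [expSeries_eq_egf_isolatedWeight hA, funext (weightSeq_edgeless w)]
  exact ggf_eq_expHadamard_mul hw (weightSeqMarked_withComponentsIn hA)

-- With `0 ^ 0 = 1`, setting the mark to zero keeps only the empty digraph.
omit [CharZero K] in
lemma ggf_weightSeqMarked_zero : ggf w (weightSeqMarked w 0 (withComponentsIn A)) = 1 := by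
  ext n
  rw [coeff_ggf, PowerSeries.coeff_one, weightSeqMarked, Finset.sum_filter]
  rcases n with _ | n
  · rw [Fintype.sum_unique, if_pos ((mem_withComponentsIn_iff hA).2 fun v => v.elim0)]
    simp [edgeCount, sourceLikeCount_eq_card, sourceComponents, components]
  · simp [sourceLikeCount_ne_zero]

end GeneratingFunctions

lemma one_add_w_ne_zero : (1 : Coefficients) + w ≠ 0 := by
  intro h
  have h' : algebraMap (MvPolynomial (Fin 2) ℚ) Coefficients (1 + MvPolynomial.X 0) =
      algebraMap _ _ 0 := by
    rw [map_add, map_one, map_zero]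
    exact h
  -- At the origin the polynomial `1 + X 0` takes the value `1`.
  have := congrArg (MvPolynomial.eval 0) (IsFractionRing.injective _ _ h')
  simp at this

end LabelledDigraph

end

open LabelledDigraph in
theorem theorem3p4 (A : Family)
    (hA : ∀ (n : ℕ), ∀ G ∈ A n, Loopless G ∧ StronglyConnected G)
    (hne : ∃ n : ℕ, (A n).Nonempty) :
    IsUnit (expHadamard (familyGGF edgeless) (expSeries (-familyEGF A))) ∧
    familyGGF (withComponentsIn A) =
      (expHadamard (familyGGF edgeless) (expSeries (-familyEGF A)))⁻¹ ∧
    familyGGFMarked (withComponentsIn A) =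
      expHadamard (familyGGF edgeless)
          (expSeries (PowerSeries.C (u - 1) * familyEGF A)) *
        (expHadamard (familyGGF edgeless) (expSeries (-familyEGF A)))⁻¹ := by
  -- At `t = -1` the mark `1 + t` is zero and the left side collapses to `1`.
  have h₁ := ggf_weightSeqMarked hA one_add_w_ne_zero (-1)
  have h₂ := ggf_weightSeqMarked hA one_add_w_ne_zero (u - 1)
  rw [add_neg_cancel, ggf_weightSeqMarked_zero hA, map_neg, map_one, neg_one_mul] at h₁
  rw [add_sub_cancel] at h₂
  change 1 = expHadamard (familyGGF edgeless) (expSeries (-familyEGF A)) *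
    familyGGF (withComponentsIn A) at h₁
  have hu := IsUnit.of_mul_eq_one _ h₁.symm
  have hc := PowerSeries.isUnit_iff_constantCoeff.1 hu
  have hinv : familyGGF (withComponentsIn A) =
      (expHadamard (familyGGF edgeless) (expSeries (-familyEGF A)))⁻¹ :=
    (PowerSeries.eq_inv_iff_mul_eq_one hc.ne_zero).2 (by rw [mul_comm, ← h₁])
  refine ⟨hu, hinv, ?_⟩
  rw [← hinv]
  exact h₂
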